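/- Consider the higher-order $\pi$-calculus with passivation, whose processes and terms are $$P,Q ::= 0 \mid a(X).P \mid \bar a\langle M\rangle.P \mid (P\mid Q) \mid a[P] \mid \nu a.P \mid {!}P \mid \mathit{run}(M), \qquad M,N ::= X \mid {`P},$$ where names $a$ serve as channels and as locations, $`P$ is the process $P$ quoted as a term, and processes are taken up to $\alpha$-conversion. Its transitions $P \xrightarrow{\alpha} P'$, with $\alpha$ one of $\tau$, $a(M)$, $\nu\tilde b.\bar a\langle M\rangle$, are those of the (early) higher-order $\pi$-calculus, with ${!}P \xrightarrow{\alpha} P'$ whenever ${!}P\mid P\xrightarrow{\alpha}P'$, together with $a[P]\xrightarrow{\alpha}a[P']$ if $P\xrightarrow{\alpha}P'$ (transparency), $a[P]\xrightarrow{\bar a\langle `P\rangle}0$ (passivation), and $\mathit{run}(`P)\xrightarrow{\tau}P$. Reduction-closed barbed equivalence $\approx$ is the largest binary relation on variable-closed processes such that $P\approx Q$ implies: (1) if $P\xrightarrow{\tau}P'$ then $Q\xrightarrow{\tau}{}^{*}Q'$ and $P'\approx Q'$ for some $Q'$; (2) if $P$ can immediately perform an input from (respectively, an output to) a name $a$,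 then $Q$ can do so after zero or more $\tau$-transitions; (3) the converses of (1) and (2) on $Q$'s transitions; (4) $P\mid R\approx Q\mid R$ for every variable-closed process $R$. Then for all distinct names $c$ and $f$, $$c(X).\mathit{run}(X)\;\approx\;\nu f.\bigl(f[c(X).\mathit{run}(X)]\;\mid\;{!}f(Y).f[\mathit{run}(Y)]\bigr).$$ -/

import Mathlib

/-! Higher-order pi-calculus with passivation, in locally nameless style: free names are atoms,
names bound by restriction and variables bound by input are de Bruijn indices, so that
alpha-equivalent processes are equal. -/

namespace HOPiP

/-- Names, used both as channels and as locations: a countably infinite set. -/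
abbrev Name := ℕ

/-- An occurrence of a name: a free name, or the name bound by the `i`-th enclosing restriction. -/
inductive NameRef where
  | free (a : Name)
  | bound (i : ℕ)

instance : Coe Name NameRef := ⟨NameRef.free⟩

mutual
/-- Processes `0`, `a(X).P`, `ā⟨M⟩.P`, `P | Q`, `a[P]`, `νa.P`, `!P`, `run(M)`. In `inp a P` the
variable index `0` of `P`, and in `nu P` the bound name index `0` of `P`, is the one bound there. -/
inductive Proc where
  | nil
  | inp (a : NameRef) (P : Proc)
  | out (a : NameRef) (M : Tm) (P : Proc)
  | par (P Q : Proc)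
  | loc (a : NameRef) (P : Proc)
  | nu (P : Proc)
  | bang (P : Proc)
  | run (M : Tm)
/-- Terms: variables `X`, and quoted processes. -/
inductive Tm where
  | var (i : ℕ)
  | quote (P : Proc)
end

/-! ### Free names -/

def NameRef.fn : NameRef → Finset Name
  | .free a => {a}
  | .bound _ => ∅

mutual
/-- The free names of a process. -/
def Proc.fn : Proc → Finset Name
  | .nil => ∅
  | .inp a P => a.fn ∪ P.fn
  | .out a M P => a.fn ∪ (M.fn ∪ P.fn)
  | .par P Q => P.fn ∪ Q.fn
  | .loc a P => a.fn ∪ P.fn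
  | .nu P => P.fn
  | .bang P => P.fn
  | .run M => M.fn
/-- The free names of a term. -/
def Tm.fn : Tm → Finset Name
  | .var _ => ∅
  | .quote P => P.fn
end

/-! ### Well-scopedness -/

def NameRef.WF (n : ℕ) : NameRef → Prop
  | .free _ => True
  | .bound i => i < n

mutual
/-- All bound name indices point to one of the enclosing restrictions or one of `n` further
ones, and all variable indices to one of the enclosing inputs or one of `v` further ones. -/
def Proc.WF : ℕ → ℕ → Proc → Prop
  | _, _, .nil => True
  | n, v, .inp a P => a.WF n ∧ P.WF n (v + 1)
  | n, v, .out a M P => a.WF n ∧ M.WF n v ∧ P.WF n v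
  | n, v, .par P Q => P.WF n v ∧ Q.WF n v
  | n, v, .loc a P => a.WF n ∧ P.WF n v
  | n, v, .nu P => P.WF (n + 1) v
  | n, v, .bang P => P.WF n v
  | n, v, .run M => M.WF n v
def Tm.WF : ℕ → ℕ → Tm → Prop
  | _, v, .var i => i < v
  | n, v, .quote P => P.WF n v
end

/-- `P` is a variable-closed process (its free names are atoms). -/
def Proc.Closed (P : Proc) : Prop := P.WF 0 0

/-- `M` is a variable-closed term (its free names are atoms). -/
def Tm.Closed (M : Tm) : Prop := M.WF 0 0

/-! ### Opening and closing a restriction -/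

def NameRef.openAt (k : ℕ) (c : Name) : NameRef → NameRef
  | .free a => .free a
  | .bound i => if i = k then .free c else .bound i

mutual
/-- Replace the bound name with index `k` (counted at the root) by the free name `c`. -/
def Proc.openAt (k : ℕ) (c : Name) : Proc → Proc
  | .nil => .nil
  | .inp a P => .inp (a.openAt k c) (P.openAt k c)
  | .out a M P => .out (a.openAt k c) (M.openAt k c) (P.openAt k c)
  | .par P Q => .par (P.openAt k c) (Q.openAt k c)
  | .loc a P => .loc (a.openAt k c) (P.openAt k c)
  | .nu P => .nu (P.openAt (k + 1) c)
  | .bang P => .bang (P.openAt k c)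
  | .run M => .run (M.openAt k c)
def Tm.openAt (k : ℕ) (c : Name) : Tm → Tm
  | .var i => .var i
  | .quote P => .quote (P.openAt k c)
end

def NameRef.closeAt (k : ℕ) (c : Name) : NameRef → NameRef
  | .free a => if a = c then .bound k else .free a
  | .bound i => .bound i

mutual
/-- Replace the free name `c` by the bound name with index `k` (counted at the root). -/
def Proc.closeAt (k : ℕ) (c : Name) : Proc → Proc
  | .nil => .nil
  | .inp a P => .inp (a.closeAt k c) (P.closeAt k c)
  | .out a M P => .out (a.closeAt k c) (M.closeAt k c) (P.closeAt k c)
  | .par P Q => .par (P.closeAt k c) (Q.closeAt k c)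
  | .loc a P => .loc (a.closeAt k c) (P.closeAt k c)
  | .nu P => .nu (P.closeAt (k + 1) c)
  | .bang P => .bang (P.closeAt k c)
  | .run M => .run (M.closeAt k c)
def Tm.closeAt (k : ℕ) (c : Name) : Tm → Tm
  | .var i => .var i
  | .quote P => .quote (P.closeAt k c)
end

/-- The restriction `νc.P`, for a process `P` in which the name `c` is written as an atom. -/
def Proc.res (c : Name) (P : Proc) : Proc := .nu (P.closeAt 0 c)

/-- The iterated restriction `νb₁. … νbₙ.P`. -/
def Proc.resList (bs : List Name) (P : Proc) : Proc := bs.foldr Proc.res P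

/-! ### Substitution of a closed term for a variable -/

mutual
/-- Replace the variable with index `k` (counted at the root) by the closed term `M`. There is
nothing to shift, since `M` has neither dangling variables nor dangling bound names. -/
def Proc.subst (k : ℕ) (M : Tm) : Proc → Proc
  | .nil => .nil
  | .inp a P => .inp a (P.subst (k + 1) M)
  | .out a N P => .out a (Tm.subst k M N) (P.subst k M)
  | .par P Q => .par (P.subst k M) (Q.subst k M)
  | .loc a P => .loc a (P.subst k M)
  | .nu P => .nu (P.subst k M)
  | .bang P => .bang (P.subst k M)
  | .run N => .run (Tm.subst k M N)
def Tm.subst (k : ℕ) (M : Tm) : Tm → Tm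
  | .var i => if i = k then M else .var i
  | .quote P => .quote (P.subst k M)
end

/-! ### Labelled transitions -/

/-- Actions: `τ`, the input `a(M)`, and the output `νb₁…bₙ.ā⟨M⟩`. -/
inductive Act where
  | tau
  | inp (a : Name) (M : Tm)
  | out (bs : List Name) (a : Name) (M : Tm)

/-- The bound names of an action. -/
def Act.bn : Act → Finset Name
  | .tau => ∅
  | .inp _ _ => ∅
  | .out bs _ _ => bs.toFinset

/-- The names of an action. -/
def Act.names : Act → Finset Name
  | .tau => ∅
  | .inp a M => {a} ∪ M.fn
  | .out bs a M => bs.toFinset ∪ ({a} ∪ M.fn)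

/-- The labelled transition system. In `guard` and `extr` the process `νc.P` is written `nu P`;
its bound name is first given a name `c` that is not free in `nu P` (alpha-conversion). -/
inductive Step : Proc → Act → Proc → Prop
  | hoIn {a : Name} {P : Proc} {M : Tm} (hM : M.Closed) :
      Step (.inp a P) (.inp a M) (P.subst 0 M)
  | hoOut {a : Name} {M : Tm} {P : Proc} :
      Step (.out a M P) (.out [] a M) P
  | parL {P₁ P₁' P₂ : Proc} {α : Act} (h : Step P₁ α P₁') (hb : Disjoint α.bn P₂.fn) :
      Step (.par P₁ P₂) α (.par P₁' P₂)
  | parR {P₁ P₂ P₂' : Proc} {α : Act} (h : Step P₂ α P₂') (hb : Disjoint α.bn P₁.fn) :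
      Step (.par P₁ P₂) α (.par P₁ P₂')
  | rep {P P' : Proc} {α : Act} (h : Step (.par (.bang P) P) α P') :
      Step (.bang P) α P'
  | reactL {P₁ P₁' P₂ P₂' : Proc} {bs : List Name} {a : Name} {M : Tm}
      (h₁ : Step P₁ (.out bs a M) P₁') (h₂ : Step P₂ (.inp a M) P₂')
      (hb : Disjoint bs.toFinset P₂.fn) :
      Step (.par P₁ P₂) .tau (.resList bs (.par P₁' P₂'))
  | reactR {P₁ P₁' P₂ P₂' : Proc} {bs : List Name} {a : Name} {M : Tm}
      (h₁ : Step P₁ (.inp a M) P₁') (h₂ : Step P₂ (.out bs a M) P₂')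
      (hb : Disjoint bs.toFinset P₁.fn) :
      Step (.par P₁ P₂) .tau (.resList bs (.par P₁' P₂'))
  | guard {c : Name} {P P' : Proc} {α : Act} (hc : c ∉ P.fn)
      (h : Step (P.openAt 0 c) α P') (hα : c ∉ α.names) :
      Step (.nu P) α (.res c P')
  | extr {c : Name} {P P' : Proc} {bs : List Name} {a : Name} {M : Tm} (hc : c ∉ P.fn)
      (h : Step (P.openAt 0 c) (.out bs a M) P') (hca : c ≠ a) (hcM : c ∈ M.fn) (hcb : c ∉ bs) :
      Step (.nu P) (.out (bs ++ [c]) a M) P'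
  | transp {a : NameRef} {P P' : Proc} {α : Act} (h : Step P α P') :
      Step (.loc a P) α (.loc a P')
  | passiv {a : Name} {P : Proc} :
      Step (.loc a P) (.out [] a (.quote P)) .nil
  | run {P : Proc} :
      Step (.run (.quote P)) .tau P

/-- Weak internal transitions: zero or more `τ` steps. -/
def WeakTau : Proc → Proc → Prop := Relation.ReflTransGen (fun P P' => Step P .tau P')

/-! ### Reduction-closed barbed equivalence -/

/-- Barbs: the ability to input from, or to output to, a name. -/
inductive Barb where
  | inp (a : Name)
  | out (a : Name)

/-- `P` can immediately exhibit the barb. -/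
def Proc.HasBarb (P : Proc) : Barb → Prop
  | .inp a => ∃ M P', Step P (.inp a M) P'
  | .out a => ∃ bs M P', Step P (.out bs a M) P'

/-- `P` can exhibit the barb after zero or more internal transitions. -/
def Proc.HasWeakBarb (P : Proc) (μ : Barb) : Prop := ∃ P', WeakTau P P' ∧ P'.HasBarb μ

/-- A binary relation on variable-closed processes that is reduction-closed, preserves barbs (in
both directions) and is preserved by parallel composition with arbitrary processes. -/
structure IsBarbed (S : Proc → Proc → Prop) : Prop where
  closed_left : ∀ {P Q}, S P Q → P.Closed
  closed_right : ∀ {P Q}, S P Q → Q.Closed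
  tau_left : ∀ {P Q P'}, S P Q → Step P .tau P' → ∃ Q', WeakTau Q Q' ∧ S P' Q'
  tau_right : ∀ {P Q Q'}, S P Q → Step Q .tau Q' → ∃ P', WeakTau P P' ∧ S P' Q'
  barb_left : ∀ {P Q μ}, S P Q → P.HasBarb μ → Q.HasWeakBarb μ
  barb_right : ∀ {P Q μ}, S P Q → Q.HasBarb μ → P.HasWeakBarb μ
  par : ∀ {P Q}, S P Q → ∀ R : Proc, R.Closed → S (.par P R) (.par Q R)

/-- Reduction-closed barbed equivalence: the largest relation satisfying `IsBarbed`. -/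
def BarbedEquiv (P Q : Proc) : Prop := ∃ S, IsBarbed S ∧ S P Q

end HOPiP

open HOPiP

namespace HOPiP

/-! ### Renaming of free names by a permutation -/

-- The equivalence holds for every closed `P` not mentioning `f` (`barbedEquiv_hosted`). Since `f`
-- is private, the location at `f` can only be passivated by one of the handlers, which restarts the
-- quoted content at `f`. So every reachable state consists of one location holding the current
-- process behind some pending `run`s, together with inert handlers (`Host`).
--
-- Hence `Hosted` is a weak bisimulation with identical labels. An internal move of the host is
-- matched by standing still (`Host.step_inv`); a move of `P` is matched by first executing the
-- pending `run`s and then acting through the transparent location (`Host.weak`). Passivation and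
-- handler inputs have subject `f`, which the restriction blocks. Messages can be compared by plain
-- equality because whatever `P` emits, its host emits verbatim.
--
-- Simulations with identical labels survive parallel composition and restriction
-- (`IsNamedSim.cl_sim`), which is all that barbed equivalence requires; restriction enters because
-- communication may extrude names. Closure under locations is neither needed nor available by this
-- route, since passivating two related processes emits two different quotations. Equality of free
-- names transfers the freshness side conditions, and equivariance handles the choice of bound
-- names.

def NameRef.perm (π : Equiv.Perm Name) : NameRef → NameRef
  | .free a => .free (π a)
  | .bound i => .bound i

mutual
/-- Rename the free names of a process by a permutation. -/
def Proc.perm (π : Equiv.Perm Name) : Proc → Proc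
  | .nil => .nil
  | .inp a P => .inp (a.perm π) (P.perm π)
  | .out a M P => .out (a.perm π) (M.perm π) (P.perm π)
  | .par P Q => .par (P.perm π) (Q.perm π)
  | .loc a P => .loc (a.perm π) (P.perm π)
  | .nu P => .nu (P.perm π)
  | .bang P => .bang (P.perm π)
  | .run M => .run (M.perm π)
/-- Rename the free names of a term by a permutation. -/
def Tm.perm (π : Equiv.Perm Name) : Tm → Tm
  | .var i => .var i
  | .quote P => .quote (P.perm π)
end

/-! ### Well-scopedness under the syntactic operations -/

theorem NameRef.WF.mono {a : NameRef} {n m : ℕ} (hnm : n ≤ m) (h : a.WF n) : a.WF m := by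
  cases a
  · trivial
  · exact lt_of_lt_of_le h hnm

mutual
theorem Proc.WF.mono : ∀ {P : Proc} {n v m w : ℕ}, n ≤ m → v ≤ w → P.WF n v → P.WF m w
  | .nil, _, _, _, _, _, _, _ => by simp [Proc.WF]
  | .inp _ P, _, _, _, _, hn, hv, h => by
      simp only [Proc.WF] at h ⊢
      exact ⟨h.1.mono hn, Proc.WF.mono (P := P) hn (by omega) h.2⟩
  | .out _ M P, _, _, _, _, hn, hv, h => by
      simp only [Proc.WF] at h ⊢
      exact ⟨h.1.mono hn, Tm.WF.mono (M := M) hn hv h.2.1, Proc.WF.mono (P := P) hn hv h.2.2⟩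
  | .par P Q, _, _, _, _, hn, hv, h => by
      simp only [Proc.WF] at h ⊢
      exact ⟨Proc.WF.mono (P := P) hn hv h.1, Proc.WF.mono (P := Q) hn hv h.2⟩
  | .loc _ P, _, _, _, _, hn, hv, h => by
      simp only [Proc.WF] at h ⊢
      exact ⟨h.1.mono hn, Proc.WF.mono (P := P) hn hv h.2⟩
  | .nu P, _, _, _, _, hn, hv, h => by
      simp only [Proc.WF] at h ⊢
      exact Proc.WF.mono (P := P) (by omega) hv h
  | .bang P, _, _, _, _, hn, hv, h => by
      simp only [Proc.WF] at h ⊢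
      exact Proc.WF.mono (P := P) hn hv h
  | .run M, _, _, _, _, hn, hv, h => by
      simp only [Proc.WF] at h ⊢
      exact Tm.WF.mono (M := M) hn hv h
theorem Tm.WF.mono : ∀ {M : Tm} {n v m w : ℕ}, n ≤ m → v ≤ w → M.WF n v → M.WF m w
  | .var _, _, _, _, _, _, hv, h => by
      simp only [Tm.WF] at h ⊢
      omega
  | .quote P, _, _, _, _, hn, hv, h => by
      simp only [Tm.WF] at h ⊢
      exact Proc.WF.mono (P := P) hn hv h
end

theorem NameRef.wf_openAt {a : NameRef} {k : ℕ} {c : Name} :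
    (a.openAt k c).WF k ↔ a.WF (k + 1) := by
  cases a with
  | free a => simp [NameRef.openAt, NameRef.WF]
  | bound i =>
    by_cases h : i = k
    · simp [NameRef.openAt, NameRef.WF, h]
    · simp only [NameRef.openAt, NameRef.WF, h, if_false]
      omega

mutual
theorem Proc.wf_openAt (c : Name) : ∀ (P : Proc) (k v : ℕ),
    (P.openAt k c).WF k v ↔ P.WF (k + 1) v
  | .nil, _, _ => by simp [Proc.openAt, Proc.WF]
  | .inp _ P, k, v => by simp [Proc.openAt, Proc.WF, NameRef.wf_openAt, Proc.wf_openAt c P]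
  | .out _ M P, k, v => by
      simp [Proc.openAt, Proc.WF, NameRef.wf_openAt, Proc.wf_openAt c P, Tm.wf_openAt c M]
  | .par P Q, k, v => by simp [Proc.openAt, Proc.WF, Proc.wf_openAt c P, Proc.wf_openAt c Q]
  | .loc _ P, k, v => by simp [Proc.openAt, Proc.WF, NameRef.wf_openAt, Proc.wf_openAt c P]
  | .nu P, k, v => by simp [Proc.openAt, Proc.WF, Proc.wf_openAt c P]
  | .bang P, k, v => by simp [Proc.openAt, Proc.WF, Proc.wf_openAt c P]
  | .run M, k, v => by simp [Proc.openAt, Proc.WF, Tm.wf_openAt c M]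
theorem Tm.wf_openAt (c : Name) : ∀ (M : Tm) (k v : ℕ),
    (M.openAt k c).WF k v ↔ M.WF (k + 1) v
  | .var _, _, _ => by simp [Tm.openAt, Tm.WF]
  | .quote P, k, v => by simp [Tm.openAt, Tm.WF, Proc.wf_openAt c P]
end

theorem NameRef.WF.closeAt {a : NameRef} {k : ℕ} (c : Name) (h : a.WF k) :
    (a.closeAt k c).WF (k + 1) := by
  cases a with
  | free a =>
    by_cases h : a = c <;> simp [NameRef.closeAt, NameRef.WF, h]
  | bound i => exact Nat.lt_succ_of_lt h

mutual
theorem Proc.WF.closeAt (c : Name) : ∀ {P : Proc} {k v : ℕ},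
    P.WF k v → (P.closeAt k c).WF (k + 1) v
  | .nil, _, _, _ => by simp [Proc.closeAt, Proc.WF]
  | .inp _ P, _, _, h => by
      simp only [Proc.closeAt, Proc.WF] at h ⊢
      exact ⟨h.1.closeAt c, Proc.WF.closeAt c (P := P) h.2⟩
  | .out _ M P, _, _, h => by
      simp only [Proc.closeAt, Proc.WF] at h ⊢
      exact ⟨h.1.closeAt c, Tm.WF.closeAt c (M := M) h.2.1, Proc.WF.closeAt c (P := P) h.2.2⟩
  | .par P Q, _, _, h => by
      simp only [Proc.closeAt, Proc.WF] at h ⊢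
      exact ⟨Proc.WF.closeAt c (P := P) h.1, Proc.WF.closeAt c (P := Q) h.2⟩
  | .loc _ P, _, _, h => by
      simp only [Proc.closeAt, Proc.WF] at h ⊢
      exact ⟨h.1.closeAt c, Proc.WF.closeAt c (P := P) h.2⟩
  | .nu P, _, _, h => by
      simp only [Proc.closeAt, Proc.WF] at h ⊢
      exact Proc.WF.closeAt c (P := P) h
  | .bang P, _, _, h => by
      simp only [Proc.closeAt, Proc.WF] at h ⊢
      exact Proc.WF.closeAt c (P := P) h
  | .run M, _, _, h => by
      simp only [Proc.closeAt, Proc.WF] at h ⊢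
      exact Tm.WF.closeAt c (M := M) h
theorem Tm.WF.closeAt (c : Name) : ∀ {M : Tm} {k v : ℕ},
    M.WF k v → (M.closeAt k c).WF (k + 1) v
  | .var _, _, _, h => by simpa [Tm.closeAt, Tm.WF] using h
  | .quote P, _, _, h => by
      simp only [Tm.closeAt, Tm.WF] at h ⊢
      exact Proc.WF.closeAt c (P := P) h
end

mutual
theorem Proc.WF.subst {M : Tm} (hM : M.Closed) : ∀ {P : Proc} {n k : ℕ},
    P.WF n (k + 1) → (P.subst k M).WF n k
  | .nil, _, _, _ => by simp [Proc.subst, Proc.WF]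
  | .inp _ P, _, _, h => by
      simp only [Proc.subst, Proc.WF] at h ⊢
      exact ⟨h.1, Proc.WF.subst hM (P := P) h.2⟩
  | .out _ N P, _, _, h => by
      simp only [Proc.subst, Proc.WF] at h ⊢
      exact ⟨h.1, Tm.WF.subst hM (N := N) h.2.1, Proc.WF.subst hM (P := P) h.2.2⟩
  | .par P Q, _, _, h => by
      simp only [Proc.subst, Proc.WF] at h ⊢
      exact ⟨Proc.WF.subst hM (P := P) h.1, Proc.WF.subst hM (P := Q) h.2⟩
  | .loc _ P, _, _, h => by
      simp only [Proc.subst, Proc.WF] at h ⊢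
      exact ⟨h.1, Proc.WF.subst hM (P := P) h.2⟩
  | .nu P, _, _, h => by
      simp only [Proc.subst, Proc.WF] at h ⊢
      exact Proc.WF.subst hM (P := P) h
  | .bang P, _, _, h => by
      simp only [Proc.subst, Proc.WF] at h ⊢
      exact Proc.WF.subst hM (P := P) h
  | .run N, _, _, h => by
      simp only [Proc.subst, Proc.WF] at h ⊢
      exact Tm.WF.subst hM (N := N) h
theorem Tm.WF.subst {M : Tm} (hM : M.Closed) : ∀ {N : Tm} {n k : ℕ},
    N.WF n (k + 1) → (Tm.subst k M N).WF n k
  | .var i, n, k, h => by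
      by_cases hik : i = k
      · simpa [Tm.subst, hik] using hM.mono (Nat.zero_le n) (Nat.zero_le k)
      · simp only [Tm.subst, hik, if_false, Tm.WF] at h ⊢
        omega
  | .quote P, _, _, h => by
      simp only [Tm.subst, Tm.WF] at h ⊢
      exact Proc.WF.subst hM (P := P) h
end

theorem NameRef.wf_perm {π : Equiv.Perm Name} {a : NameRef} {n : ℕ} :
    (a.perm π).WF n ↔ a.WF n := by
  cases a <;> simp [NameRef.perm, NameRef.WF]

mutual
theorem Proc.wf_perm (π : Equiv.Perm Name) : ∀ (P : Proc) (n v : ℕ),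
    (P.perm π).WF n v ↔ P.WF n v
  | .nil, _, _ => by simp [Proc.perm]
  | .inp _ P, _, _ => by simp [Proc.perm, Proc.WF, NameRef.wf_perm, Proc.wf_perm π P]
  | .out _ M P, _, _ => by
      simp [Proc.perm, Proc.WF, NameRef.wf_perm, Proc.wf_perm π P, Tm.wf_perm π M]
  | .par P Q, _, _ => by simp [Proc.perm, Proc.WF, Proc.wf_perm π P, Proc.wf_perm π Q]
  | .loc _ P, _, _ => by simp [Proc.perm, Proc.WF, NameRef.wf_perm, Proc.wf_perm π P]
  | .nu P, _, _ => by simp [Proc.perm, Proc.WF, Proc.wf_perm π P]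
  | .bang P, _, _ => by simp [Proc.perm, Proc.WF, Proc.wf_perm π P]
  | .run M, _, _ => by simp [Proc.perm, Proc.WF, Tm.wf_perm π M]
theorem Tm.wf_perm (π : Equiv.Perm Name) : ∀ (M : Tm) (n v : ℕ),
    (M.perm π).WF n v ↔ M.WF n v
  | .var _, _, _ => by simp [Tm.perm]
  | .quote P, _, _ => by simp [Tm.perm, Tm.WF, Proc.wf_perm π P]
end

/-! ### Opening, closing and permuting -/

theorem NameRef.openAt_eq_self {a : NameRef} {k : ℕ} (c : Name) (h : a.WF k) :
    a.openAt k c = a := by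
  cases a with
  | free a => rfl
  | bound i => simp [NameRef.openAt, Nat.ne_of_lt h]

mutual
theorem Proc.openAt_eq_self (c : Name) : ∀ {P : Proc} {k v : ℕ}, P.WF k v → P.openAt k c = P
  | .nil, _, _, _ => by simp [Proc.openAt]
  | .inp _ P, _, _, h => by
      simp only [Proc.WF] at h
      simp [Proc.openAt, NameRef.openAt_eq_self c h.1, Proc.openAt_eq_self c (P := P) h.2]
  | .out _ M P, _, _, h => by
      simp only [Proc.WF] at h
      simp [Proc.openAt, NameRef.openAt_eq_self c h.1, Tm.openAt_eq_self c (M := M) h.2.1,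
        Proc.openAt_eq_self c (P := P) h.2.2]
  | .par P Q, _, _, h => by
      simp only [Proc.WF] at h
      simp [Proc.openAt, Proc.openAt_eq_self c (P := P) h.1, Proc.openAt_eq_self c (P := Q) h.2]
  | .loc _ P, _, _, h => by
      simp only [Proc.WF] at h
      simp [Proc.openAt, NameRef.openAt_eq_self c h.1, Proc.openAt_eq_self c (P := P) h.2]
  | .nu P, _, _, h => by
      simp only [Proc.WF] at h
      simp [Proc.openAt, Proc.openAt_eq_self c (P := P) h]
  | .bang P, _, _, h => by
      simp only [Proc.WF] at h
      simp [Proc.openAt, Proc.openAt_eq_self c (P := P) h]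
  | .run M, _, _, h => by
      simp only [Proc.WF] at h
      simp [Proc.openAt, Tm.openAt_eq_self c (M := M) h]
theorem Tm.openAt_eq_self (c : Name) : ∀ {M : Tm} {k v : ℕ}, M.WF k v → M.openAt k c = M
  | .var _, _, _, _ => by simp [Tm.openAt]
  | .quote P, _, _, h => by
      simp only [Tm.WF] at h
      simp [Tm.openAt, Proc.openAt_eq_self c (P := P) h]
end

theorem NameRef.closeAt_eq_self {a : NameRef} {c : Name} (k : ℕ) (h : c ∉ a.fn) :
    a.closeAt k c = a := by
  cases a with
  | free a =>
    have : a ≠ c := by rintro rfl; simp [NameRef.fn] at h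
    simp [NameRef.closeAt, this]
  | bound i => rfl

mutual
theorem Proc.closeAt_eq_self {c : Name} : ∀ {P : Proc} (k : ℕ), c ∉ P.fn → P.closeAt k c = P
  | .nil, _, _ => by simp [Proc.closeAt]
  | .inp _ P, k, h => by
      simp only [Proc.fn, Finset.mem_union, not_or] at h
      simp [Proc.closeAt, NameRef.closeAt_eq_self k h.1, Proc.closeAt_eq_self (P := P) k h.2]
  | .out _ M P, k, h => by
      simp only [Proc.fn, Finset.mem_union, not_or] at h
      simp [Proc.closeAt, NameRef.closeAt_eq_self k h.1, Tm.closeAt_eq_self (M := M) k h.2.1,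
        Proc.closeAt_eq_self (P := P) k h.2.2]
  | .par P Q, k, h => by
      simp only [Proc.fn, Finset.mem_union, not_or] at h
      simp [Proc.closeAt, Proc.closeAt_eq_self (P := P) k h.1,
        Proc.closeAt_eq_self (P := Q) k h.2]
  | .loc _ P, k, h => by
      simp only [Proc.fn, Finset.mem_union, not_or] at h
      simp [Proc.closeAt, NameRef.closeAt_eq_self k h.1, Proc.closeAt_eq_self (P := P) k h.2]
  | .nu P, k, h => by
      simp only [Proc.fn] at h
      simp [Proc.closeAt, Proc.closeAt_eq_self (P := P) (k + 1) h]
  | .bang P, k, h => by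
      simp only [Proc.fn] at h
      simp [Proc.closeAt, Proc.closeAt_eq_self (P := P) k h]
  | .run M, k, h => by
      simp only [Proc.fn] at h
      simp [Proc.closeAt, Tm.closeAt_eq_self (M := M) k h]
theorem Tm.closeAt_eq_self {c : Name} : ∀ {M : Tm} (k : ℕ), c ∉ M.fn → M.closeAt k c = M
  | .var _, _, _ => by simp [Tm.closeAt]
  | .quote P, k, h => by
      simp only [Tm.fn] at h
      simp [Tm.closeAt, Proc.closeAt_eq_self (P := P) k h]
end

theorem NameRef.closeAt_openAt {a : NameRef} {c : Name} (k : ℕ) (h : c ∉ a.fn) :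
    (a.openAt k c).closeAt k c = a := by
  cases a with
  | free a =>
    have : a ≠ c := by rintro rfl; simp [NameRef.fn] at h
    simp [NameRef.openAt, NameRef.closeAt, this]
  | bound i => by_cases h : i = k <;> simp [NameRef.openAt, NameRef.closeAt, h]

mutual
theorem Proc.closeAt_openAt {c : Name} : ∀ {P : Proc} (k : ℕ), c ∉ P.fn →
    (P.openAt k c).closeAt k c = P
  | .nil, _, _ => by simp [Proc.openAt, Proc.closeAt]
  | .inp _ P, k, h => by
      simp only [Proc.fn, Finset.mem_union, not_or] at h
      simp [Proc.openAt, Proc.closeAt, NameRef.closeAt_openAt k h.1,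
        Proc.closeAt_openAt (P := P) k h.2]
  | .out _ M P, k, h => by
      simp only [Proc.fn, Finset.mem_union, not_or] at h
      simp [Proc.openAt, Proc.closeAt, NameRef.closeAt_openAt k h.1,
        Tm.closeAt_openAt (M := M) k h.2.1, Proc.closeAt_openAt (P := P) k h.2.2]
  | .par P Q, k, h => by
      simp only [Proc.fn, Finset.mem_union, not_or] at h
      simp [Proc.openAt, Proc.closeAt, Proc.closeAt_openAt (P := P) k h.1,
        Proc.closeAt_openAt (P := Q) k h.2]
  | .loc _ P, k, h => by
      simp only [Proc.fn, Finset.mem_union, not_or] at h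
      simp [Proc.openAt, Proc.closeAt, NameRef.closeAt_openAt k h.1,
        Proc.closeAt_openAt (P := P) k h.2]
  | .nu P, k, h => by
      simp only [Proc.fn] at h
      simp [Proc.openAt, Proc.closeAt, Proc.closeAt_openAt (P := P) (k + 1) h]
  | .bang P, k, h => by
      simp only [Proc.fn] at h
      simp [Proc.openAt, Proc.closeAt, Proc.closeAt_openAt (P := P) k h]
  | .run M, k, h => by
      simp only [Proc.fn] at h
      simp [Proc.openAt, Proc.closeAt, Tm.closeAt_openAt (M := M) k h]
theorem Tm.closeAt_openAt {c : Name} : ∀ {M : Tm} (k : ℕ), c ∉ M.fn →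
    (M.openAt k c).closeAt k c = M
  | .var _, _, _ => by simp [Tm.openAt, Tm.closeAt]
  | .quote P, k, h => by
      simp only [Tm.fn] at h
      simp [Tm.openAt, Tm.closeAt, Proc.closeAt_openAt (P := P) k h]
end

/-- Renaming `c` to `d` agrees with the transposition when `d` does not already occur. Allowing `d =
c` as well makes the hypothesis exactly freshness of `d` for the closed process. This reduces
alpha-conversion to equivariance. -/
theorem NameRef.openAt_closeAt {a : NameRef} {c d : Name} {k : ℕ} (hw : a.WF k)
    (hd : d ∈ a.fn → d = c) : (a.closeAt k c).openAt k d = a.perm (Equiv.swap c d) := by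
  cases a with
  | free a =>
    by_cases hac : a = c
    · simp [NameRef.openAt, NameRef.closeAt, NameRef.perm, hac]
    · have had : a ≠ d := by
        rintro rfl
        exact hac (hd (by simp [NameRef.fn]))
      simp [NameRef.openAt, NameRef.closeAt, NameRef.perm, hac,
        Equiv.swap_apply_of_ne_of_ne hac had]
  | bound i => simp [NameRef.openAt, NameRef.closeAt, NameRef.perm, Nat.ne_of_lt hw]

mutual
theorem Proc.openAt_closeAt {c d : Name} : ∀ {P : Proc} {k v : ℕ}, P.WF k v →
    (d ∈ P.fn → d = c) → (P.closeAt k c).openAt k d = P.perm (Equiv.swap c d)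
  | .nil, _, _, _, _ => by simp [Proc.openAt, Proc.closeAt, Proc.perm]
  | .inp _ P, _, _, h, hd => by
      simp only [Proc.WF, Proc.fn, Finset.mem_union, or_imp] at h hd
      simp [Proc.openAt, Proc.closeAt, Proc.perm, NameRef.openAt_closeAt h.1 hd.1,
        Proc.openAt_closeAt (P := P) h.2 hd.2]
  | .out _ M P, _, _, h, hd => by
      simp only [Proc.WF, Proc.fn, Finset.mem_union, or_imp] at h hd
      simp [Proc.openAt, Proc.closeAt, Proc.perm, NameRef.openAt_closeAt h.1 hd.1,
        Tm.openAt_closeAt (M := M) h.2.1 hd.2.1, Proc.openAt_closeAt (P := P) h.2.2 hd.2.2]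
  | .par P Q, _, _, h, hd => by
      simp only [Proc.WF, Proc.fn, Finset.mem_union, or_imp] at h hd
      simp [Proc.openAt, Proc.closeAt, Proc.perm, Proc.openAt_closeAt (P := P) h.1 hd.1,
        Proc.openAt_closeAt (P := Q) h.2 hd.2]
  | .loc _ P, _, _, h, hd => by
      simp only [Proc.WF, Proc.fn, Finset.mem_union, or_imp] at h hd
      simp [Proc.openAt, Proc.closeAt, Proc.perm, NameRef.openAt_closeAt h.1 hd.1,
        Proc.openAt_closeAt (P := P) h.2 hd.2]
  | .nu P, _, _, h, hd => by
      simp only [Proc.WF, Proc.fn] at h hd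
      simp [Proc.openAt, Proc.closeAt, Proc.perm, Proc.openAt_closeAt (P := P) h hd]
  | .bang P, _, _, h, hd => by
      simp only [Proc.WF, Proc.fn] at h hd
      simp [Proc.openAt, Proc.closeAt, Proc.perm, Proc.openAt_closeAt (P := P) h hd]
  | .run M, _, _, h, hd => by
      simp only [Proc.WF, Proc.fn] at h hd
      simp [Proc.openAt, Proc.closeAt, Proc.perm, Tm.openAt_closeAt (M := M) h hd]
theorem Tm.openAt_closeAt {c d : Name} : ∀ {M : Tm} {k v : ℕ}, M.WF k v →
    (d ∈ M.fn → d = c) → (M.closeAt k c).openAt k d = M.perm (Equiv.swap c d)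
  | .var _, _, _, _, _ => by simp [Tm.openAt, Tm.closeAt, Tm.perm]
  | .quote P, _, _, h, hd => by
      simp only [Tm.WF, Tm.fn] at h hd
      simp [Tm.openAt, Tm.closeAt, Tm.perm, Proc.openAt_closeAt (P := P) h hd]
end

theorem NameRef.perm_one (a : NameRef) : a.perm 1 = a := by
  cases a <;> simp [NameRef.perm]

mutual
theorem Proc.perm_one : ∀ P : Proc, P.perm 1 = P
  | .nil => by simp [Proc.perm]
  | .inp _ P => by simp [Proc.perm, NameRef.perm_one, Proc.perm_one P]
  | .out _ M P => by simp [Proc.perm, NameRef.perm_one, Proc.perm_one P, Tm.perm_one M]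
  | .par P Q => by simp [Proc.perm, Proc.perm_one P, Proc.perm_one Q]
  | .loc _ P => by simp [Proc.perm, NameRef.perm_one, Proc.perm_one P]
  | .nu P => by simp [Proc.perm, Proc.perm_one P]
  | .bang P => by simp [Proc.perm, Proc.perm_one P]
  | .run M => by simp [Proc.perm, Tm.perm_one M]
theorem Tm.perm_one : ∀ M : Tm, M.perm 1 = M
  | .var _ => by simp [Tm.perm]
  | .quote P => by simp [Tm.perm, Proc.perm_one P]
end

theorem Proc.openAt_closeAt_self {c : Name} {P : Proc} {k v : ℕ} (h : P.WF k v) :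
    (P.closeAt k c).openAt k c = P := by
  rw [Proc.openAt_closeAt h (fun _ => rfl), Equiv.swap_self]
  exact Proc.perm_one P

theorem NameRef.perm_openAt (π : Equiv.Perm Name) (c : Name) (k : ℕ) (a : NameRef) :
    (a.openAt k c).perm π = (a.perm π).openAt k (π c) := by
  cases a with
  | free a => rfl
  | bound i => by_cases h : i = k <;> simp [NameRef.openAt, NameRef.perm, h]

mutual
theorem Proc.perm_openAt (π : Equiv.Perm Name) (c : Name) : ∀ (P : Proc) (k : ℕ),
    (P.openAt k c).perm π = (P.perm π).openAt k (π c)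
  | .nil, _ => by simp [Proc.openAt, Proc.perm]
  | .inp _ P, _ => by
      simp [Proc.openAt, Proc.perm, NameRef.perm_openAt, Proc.perm_openAt π c P]
  | .out _ M P, _ => by
      simp [Proc.openAt, Proc.perm, NameRef.perm_openAt, Proc.perm_openAt π c P,
        Tm.perm_openAt π c M]
  | .par P Q, _ => by
      simp [Proc.openAt, Proc.perm, Proc.perm_openAt π c P, Proc.perm_openAt π c Q]
  | .loc _ P, _ => by
      simp [Proc.openAt, Proc.perm, NameRef.perm_openAt, Proc.perm_openAt π c P]
  | .nu P, _ => by simp [Proc.openAt, Proc.perm, Proc.perm_openAt π c P]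
  | .bang P, _ => by simp [Proc.openAt, Proc.perm, Proc.perm_openAt π c P]
  | .run M, _ => by simp [Proc.openAt, Proc.perm, Tm.perm_openAt π c M]
theorem Tm.perm_openAt (π : Equiv.Perm Name) (c : Name) : ∀ (M : Tm) (k : ℕ),
    (M.openAt k c).perm π = (M.perm π).openAt k (π c)
  | .var _, _ => by simp [Tm.openAt, Tm.perm]
  | .quote P, _ => by simp [Tm.openAt, Tm.perm, Proc.perm_openAt π c P]
end

/-! ### Free names under the syntactic operations -/

theorem NameRef.mem_fn_perm {π : Equiv.Perm Name} {x : Name} {a : NameRef} :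
    π x ∈ (a.perm π).fn ↔ x ∈ a.fn := by
  cases a <;> simp [NameRef.perm, NameRef.fn]

mutual
theorem Proc.mem_fn_perm (π : Equiv.Perm Name) (x : Name) : ∀ P : Proc,
    π x ∈ (P.perm π).fn ↔ x ∈ P.fn
  | .nil => by simp [Proc.perm, Proc.fn]
  | .inp _ P => by simp [Proc.perm, Proc.fn, NameRef.mem_fn_perm, Proc.mem_fn_perm π x P]
  | .out _ M P => by
      simp [Proc.perm, Proc.fn, NameRef.mem_fn_perm, Proc.mem_fn_perm π x P,
        Tm.mem_fn_perm π x M]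
  | .par P Q => by simp [Proc.perm, Proc.fn, Proc.mem_fn_perm π x P, Proc.mem_fn_perm π x Q]
  | .loc _ P => by simp [Proc.perm, Proc.fn, NameRef.mem_fn_perm, Proc.mem_fn_perm π x P]
  | .nu P => by simp [Proc.perm, Proc.fn, Proc.mem_fn_perm π x P]
  | .bang P => by simp [Proc.perm, Proc.fn, Proc.mem_fn_perm π x P]
  | .run M => by simp [Proc.perm, Proc.fn, Tm.mem_fn_perm π x M]
theorem Tm.mem_fn_perm (π : Equiv.Perm Name) (x : Name) : ∀ M : Tm,
    π x ∈ (M.perm π).fn ↔ x ∈ M.fn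
  | .var _ => by simp [Tm.perm, Tm.fn]
  | .quote P => by simp [Tm.perm, Tm.fn, Proc.mem_fn_perm π x P]
end

theorem NameRef.mem_fn_openAt {c x : Name} (hx : x ≠ c) {k : ℕ} {a : NameRef} :
    x ∈ (a.openAt k c).fn ↔ x ∈ a.fn := by
  cases a with
  | free a => rfl
  | bound i => by_cases h : i = k <;> simp [NameRef.openAt, NameRef.fn, h, hx]

mutual
theorem Proc.mem_fn_openAt {c x : Name} (hx : x ≠ c) : ∀ (P : Proc) (k : ℕ),
    x ∈ (P.openAt k c).fn ↔ x ∈ P.fn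
  | .nil, _ => by simp [Proc.openAt, Proc.fn]
  | .inp _ P, _ => by
      simp [Proc.openAt, Proc.fn, NameRef.mem_fn_openAt hx, Proc.mem_fn_openAt hx P]
  | .out _ M P, _ => by
      simp [Proc.openAt, Proc.fn, NameRef.mem_fn_openAt hx, Proc.mem_fn_openAt hx P,
        Tm.mem_fn_openAt hx M]
  | .par P Q, _ => by
      simp [Proc.openAt, Proc.fn, Proc.mem_fn_openAt hx P, Proc.mem_fn_openAt hx Q]
  | .loc _ P, _ => by
      simp [Proc.openAt, Proc.fn, NameRef.mem_fn_openAt hx, Proc.mem_fn_openAt hx P]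
  | .nu P, _ => by simp [Proc.openAt, Proc.fn, Proc.mem_fn_openAt hx P]
  | .bang P, _ => by simp [Proc.openAt, Proc.fn, Proc.mem_fn_openAt hx P]
  | .run M, _ => by simp [Proc.openAt, Proc.fn, Tm.mem_fn_openAt hx M]
theorem Tm.mem_fn_openAt {c x : Name} (hx : x ≠ c) : ∀ (M : Tm) (k : ℕ),
    x ∈ (M.openAt k c).fn ↔ x ∈ M.fn
  | .var _, _ => by simp [Tm.openAt, Tm.fn]
  | .quote P, _ => by simp [Tm.openAt, Tm.fn, Proc.mem_fn_openAt hx P]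
end

theorem NameRef.mem_fn_closeAt {c x : Name} {k : ℕ} {a : NameRef} :
    x ∈ (a.closeAt k c).fn ↔ x ≠ c ∧ x ∈ a.fn := by
  cases a with
  | free a =>
    by_cases h : a = c
    · simp +contextual [NameRef.closeAt, NameRef.fn, h]
    · simp only [NameRef.closeAt, NameRef.fn, h, if_false, Finset.mem_singleton]
      exact ⟨fun e => ⟨e ▸ h, e⟩, And.right⟩
  | bound i => simp [NameRef.closeAt, NameRef.fn]

mutual
theorem Proc.mem_fn_closeAt (c x : Name) : ∀ (P : Proc) (k : ℕ),
    x ∈ (P.closeAt k c).fn ↔ x ≠ c ∧ x ∈ P.fn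
  | .nil, _ => by simp [Proc.closeAt, Proc.fn]
  | .inp _ P, _ => by
      simp [Proc.closeAt, Proc.fn, NameRef.mem_fn_closeAt, Proc.mem_fn_closeAt c x P, and_or_left]
  | .out _ M P, _ => by
      simp [Proc.closeAt, Proc.fn, NameRef.mem_fn_closeAt, Proc.mem_fn_closeAt c x P,
        Tm.mem_fn_closeAt c x M, and_or_left]
  | .par P Q, _ => by
      simp [Proc.closeAt, Proc.fn, Proc.mem_fn_closeAt c x P, Proc.mem_fn_closeAt c x Q,
        and_or_left]
  | .loc _ P, _ => by
      simp [Proc.closeAt, Proc.fn, NameRef.mem_fn_closeAt, Proc.mem_fn_closeAt c x P, and_or_left]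
  | .nu P, _ => by simp [Proc.closeAt, Proc.fn, Proc.mem_fn_closeAt c x P]
  | .bang P, _ => by simp [Proc.closeAt, Proc.fn, Proc.mem_fn_closeAt c x P]
  | .run M, _ => by simp [Proc.closeAt, Proc.fn, Tm.mem_fn_closeAt c x M]
theorem Tm.mem_fn_closeAt (c x : Name) : ∀ (M : Tm) (k : ℕ),
    x ∈ (M.closeAt k c).fn ↔ x ≠ c ∧ x ∈ M.fn
  | .var _, _ => by simp [Tm.closeAt, Tm.fn]
  | .quote P, _ => by simp [Tm.closeAt, Tm.fn, Proc.mem_fn_closeAt c x P]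
end

mutual
theorem Proc.fn_subst_subset (M : Tm) : ∀ (P : Proc) (k : ℕ), (P.subst k M).fn ⊆ P.fn ∪ M.fn
  | .nil, _ => by simp [Proc.subst, Proc.fn]
  | .inp _ P, k => by
      have h := Proc.fn_subst_subset M P (k + 1)
      simp only [Proc.subst, Proc.fn]
      grind
  | .out _ N P, k => by
      have h := Proc.fn_subst_subset M P k
      have h' := Tm.fn_subst_subset M N k
      simp only [Proc.subst, Proc.fn]
      grind
  | .par P Q, k => by
      have h := Proc.fn_subst_subset M P k
      have h' := Proc.fn_subst_subset M Q k
      simp only [Proc.subst, Proc.fn]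
      grind
  | .loc _ P, k => by
      have h := Proc.fn_subst_subset M P k
      simp only [Proc.subst, Proc.fn]
      grind
  | .nu P, k => by simpa only [Proc.subst, Proc.fn] using Proc.fn_subst_subset M P k
  | .bang P, k => by simpa only [Proc.subst, Proc.fn] using Proc.fn_subst_subset M P k
  | .run N, k => by simpa only [Proc.subst, Proc.fn] using Tm.fn_subst_subset M N k
theorem Tm.fn_subst_subset (M : Tm) : ∀ (N : Tm) (k : ℕ), (Tm.subst k M N).fn ⊆ N.fn ∪ M.fn
  | .var i, k => by by_cases h : i = k <;> simp [Tm.subst, Tm.fn, h]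
  | .quote P, k => by simpa only [Tm.subst, Tm.fn] using Proc.fn_subst_subset M P k
end

theorem Proc.mem_fn_res {c x : Name} {P : Proc} : x ∈ (P.res c).fn ↔ x ≠ c ∧ x ∈ P.fn := by
  simp [Proc.res, Proc.fn, Proc.mem_fn_closeAt]

theorem Proc.mem_fn_resList {x : Name} {P : Proc} (bs : List Name) :
    x ∈ (P.resList bs).fn ↔ x ∉ bs ∧ x ∈ P.fn := by
  induction bs with
  | nil => simp [Proc.resList]
  | cons b bs ih =>
    have : P.resList (b :: bs) = (P.resList bs).res b := rfl
    simp [this, Proc.mem_fn_res, ih, and_assoc]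

theorem Proc.Closed.res {P : Proc} (c : Name) (h : P.Closed) : (P.res c).Closed := by
  simp only [Proc.Closed, Proc.res, Proc.WF]
  exact Proc.WF.closeAt c h

theorem Proc.Closed.resList {P : Proc} (h : P.Closed) (bs : List Name) :
    (P.resList bs).Closed := by
  induction bs with
  | nil => exact h
  | cons b bs ih => exact ih.res b

theorem Proc.res_openAt {P : Proc} {c : Name} (hc : c ∉ P.fn) :
    (P.openAt 0 c).res c = .nu P := by
  rw [Proc.res, Proc.closeAt_openAt 0 hc]

/-! ### Basic properties of the transition system -/

theorem Step.closed {P P' : Proc} {α : Act} (h : Step P α P') : P.Closed → P'.Closed := by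
  induction h with
  | hoIn hM =>
    intro hP
    simp only [Proc.Closed, Proc.WF] at hP
    exact Proc.WF.subst hM hP.2
  | hoOut =>
    intro hP
    simp only [Proc.Closed, Proc.WF] at hP
    exact hP.2.2
  | parL _ _ ih =>
    intro hP
    simp only [Proc.Closed, Proc.WF] at hP ih ⊢
    exact ⟨ih hP.1, hP.2⟩
  | parR _ _ ih =>
    intro hP
    simp only [Proc.Closed, Proc.WF] at hP ih ⊢
    exact ⟨hP.1, ih hP.2⟩
  | rep _ ih =>
    intro hP
    simp only [Proc.Closed, Proc.WF] at hP ih ⊢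
    exact ih ⟨hP, hP⟩
  | reactL _ _ _ ih₁ ih₂ =>
    intro hP
    refine Proc.Closed.resList ?_ _
    simp only [Proc.Closed, Proc.WF] at hP ih₁ ih₂ ⊢
    exact ⟨ih₁ hP.1, ih₂ hP.2⟩
  | reactR _ _ _ ih₁ ih₂ =>
    intro hP
    refine Proc.Closed.resList ?_ _
    simp only [Proc.Closed, Proc.WF] at hP ih₁ ih₂ ⊢
    exact ⟨ih₁ hP.1, ih₂ hP.2⟩
  | guard _ _ _ ih =>
    intro hP
    simp only [Proc.Closed, Proc.WF] at hP
    exact (ih ((Proc.wf_openAt _ _ _ _).2 hP)).res _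
  | extr _ _ _ _ _ ih =>
    intro hP
    simp only [Proc.Closed, Proc.WF] at hP
    exact ih ((Proc.wf_openAt _ _ _ _).2 hP)
  | transp _ ih =>
    intro hP
    simp only [Proc.Closed, Proc.WF] at hP ih ⊢
    exact ⟨hP.1, ih hP.2⟩
  | passiv => intro _; simp [Proc.Closed, Proc.WF]
  | run =>
    intro hP
    simpa only [Proc.Closed, Proc.WF, Tm.WF] using hP

/-- How the free names of a process and its derivative are related along an action. -/
def Act.NamesLe (P : Proc) (P' : Proc) : Act → Prop
  | .tau => ∀ x ∈ P'.fn, x ∈ P.fn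
  | .inp a M => a ∈ P.fn ∧ ∀ x ∈ P'.fn, x ∈ P.fn ∨ x ∈ M.fn
  | .out bs a M =>
      a ∈ P.fn ∧ (∀ x ∈ M.fn, x ∈ P.fn ∨ x ∈ bs) ∧ ∀ x ∈ P'.fn, x ∈ P.fn ∨ x ∈ bs

/-- The name opened by a restriction cannot leak: `guard` closes it again and keeps it out of the
action, while `extr` records it among the bound names. -/
theorem Step.namesLe {P P' : Proc} {α : Act} (h : Step P α P') : α.NamesLe P P' := by
  induction h with
  | @hoIn a P M hM =>
    have := Proc.fn_subst_subset M P 0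
    simp only [Act.NamesLe, Proc.fn, NameRef.fn]
    grind
  | hoOut => simp only [Act.NamesLe, Proc.fn, NameRef.fn]; grind
  | @parL _ _ _ α _ _ ih => cases α <;> simp only [Act.NamesLe, Proc.fn] at ih ⊢ <;> grind
  | @parR _ _ _ α _ _ ih => cases α <;> simp only [Act.NamesLe, Proc.fn] at ih ⊢ <;> grind
  | @rep _ _ α _ ih =>
    cases α <;> simpa only [Act.NamesLe, Proc.fn, Finset.union_self] using ih
  | @reactL _ _ _ _ bs _ _ _ _ _ ih₁ ih₂ | @reactR _ _ _ _ bs _ _ _ _ _ ih₁ ih₂ =>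
    intro x hx
    rw [Proc.mem_fn_resList] at hx
    simp only [Act.NamesLe, Proc.fn] at ih₁ ih₂ hx ⊢
    grind
  | @guard c P P' α hc _ hα ih =>
    have key : ∀ x, x ≠ c → x ∈ (P.openAt 0 c).fn → x ∈ P.fn :=
      fun x hx h => (Proc.mem_fn_openAt hx P 0).1 h
    have res : ∀ x, x ∈ (P'.res c).fn → x ≠ c ∧ x ∈ P'.fn := fun x => Proc.mem_fn_res.1
    cases α <;> simp only [Act.NamesLe, Act.names, Proc.fn] at ih hα ⊢ <;> grind
  | @extr c P P' bs a M hc _ hca hcM hcb ih =>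
    have key : ∀ x, x ≠ c → x ∈ (P.openAt 0 c).fn → x ∈ P.fn :=
      fun x hx h => (Proc.mem_fn_openAt hx P 0).1 h
    simp only [Act.NamesLe, Proc.fn] at ih ⊢
    grind
  | @transp _ _ _ α _ ih => cases α <;> simp only [Act.NamesLe, Proc.fn] at ih ⊢ <;> grind
  | passiv => simp only [Act.NamesLe, Proc.fn, Tm.fn, NameRef.fn]; grind
  | run => simp only [Act.NamesLe, Proc.fn, Tm.fn]; grind

/-- The rule `guard` is applied with `c` itself as the representative. Closedness of `P` ensures
that reopening returns `P`, with no dangling index captured. -/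
theorem Step.res {P P' : Proc} {α : Act} {c : Name} (hP : P.Closed) (h : Step P α P')
    (hα : c ∉ α.names) : Step (P.res c) α (P'.res c) := by
  refine Step.guard (c := c) ?_ ?_ hα
  · simp [Proc.mem_fn_closeAt]
  · rwa [Proc.openAt_closeAt_self hP]

theorem WeakTau.closed {P Q : Proc} (h : WeakTau P Q) (hP : P.Closed) : Q.Closed := by
  induction h with
  | refl => exact hP
  | tail _ h ih => exact h.closed ih

theorem WeakTau.fn_subset {P Q : Proc} (h : WeakTau P Q) : Q.fn ⊆ P.fn := by
  induction h with
  | refl => exact subset_rfl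
  | tail _ h ih => exact fun x hx => ih (h.namesLe x hx)

theorem WeakTau.parL {P Q : Proc} (R : Proc) (h : WeakTau P Q) :
    WeakTau (Proc.par P R) (Proc.par Q R) := by
  induction h with
  | refl => exact .refl
  | tail _ h ih => exact ih.tail (h.parL (by simp [Act.bn]))

theorem WeakTau.parR {P Q : Proc} (R : Proc) (h : WeakTau P Q) :
    WeakTau (Proc.par R P) (Proc.par R Q) := by
  induction h with
  | refl => exact .refl
  | tail _ h ih => exact ih.tail (h.parR (by simp [Act.bn]))

theorem WeakTau.loc {P Q : Proc} (a : NameRef) (h : WeakTau P Q) :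
    WeakTau (Proc.loc a P) (Proc.loc a Q) := by
  induction h with
  | refl => exact .refl
  | tail _ h ih => exact ih.tail (h.transp)

theorem WeakTau.res {P Q : Proc} (c : Name) (hP : P.Closed) (h : WeakTau P Q) :
    WeakTau (P.res c) (Q.res c) := by
  induction h with
  | refl => exact .refl
  | tail h₁ h₂ ih => exact ih.tail (h₂.res (WeakTau.closed h₁ hP) (by simp [Act.names]))

/-- Weak transitions: internal transitions followed by the action, which may be omitted if it is
internal itself. -/
def Weak (P : Proc) (α : Act) (P' : Proc) : Prop :=
  ∃ P₁, WeakTau P P₁ ∧ (Step P₁ α P' ∨ α = .tau ∧ P' = P₁)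

theorem weak_tau_iff {P P' : Proc} : Weak P .tau P' ↔ WeakTau P P' := by
  constructor
  · rintro ⟨P₁, h, h' | ⟨-, rfl⟩⟩
    · exact Relation.ReflTransGen.tail h h'
    · exact h
  · exact fun h => ⟨P', h, .inr ⟨rfl, rfl⟩⟩

/-- A visible action comes last, so its step can serve directly as the premise of a communication or
extrusion rule. -/
theorem Weak.exists_step {P P' : Proc} {α : Act} (h : Weak P α P') (hα : α ≠ .tau) :
    ∃ P₁, WeakTau P P₁ ∧ Step P₁ α P' := by
  obtain ⟨P₁, h, h' | ⟨rfl, -⟩⟩ := h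
  · exact ⟨P₁, h, h'⟩
  · exact absurd rfl hα

theorem Weak.parL {P P' R : Proc} {α : Act} (h : Weak P α P') (hb : Disjoint α.bn R.fn) :
    Weak (.par P R) α (.par P' R) := by
  obtain ⟨P₁, h, h' | ⟨rfl, rfl⟩⟩ := h
  · exact ⟨_, h.parL R, .inl (h'.parL hb)⟩
  · exact ⟨_, h.parL R, .inr ⟨rfl, rfl⟩⟩

theorem Weak.parR {P P' R : Proc} {α : Act} (h : Weak P α P') (hb : Disjoint α.bn R.fn) :
    Weak (.par R P) α (.par R P') := by
  obtain ⟨P₁, h, h' | ⟨rfl, rfl⟩⟩ := h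
  · exact ⟨_, h.parR R, .inl (h'.parR hb)⟩
  · exact ⟨_, h.parR R, .inr ⟨rfl, rfl⟩⟩

theorem Weak.res {P P' : Proc} {α : Act} {c : Name} (hP : P.Closed) (h : Weak P α P')
    (hα : c ∉ α.names) : Weak (P.res c) α (P'.res c) := by
  obtain ⟨P₁, h, h' | ⟨rfl, rfl⟩⟩ := h
  · exact ⟨_, h.res c hP, .inl (h'.res (h.closed hP) hα)⟩
  · exact ⟨_, h.res c hP, .inr ⟨rfl, rfl⟩⟩

/-! ### Closing a simulation under parallel composition and restriction -/

/-- The closure of a relation under parallel composition with closed processes and under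
restriction. -/
inductive Cl (B : Proc → Proc → Prop) : Proc → Proc → Prop
  | base {P Q : Proc} (h : B P Q) : Cl B P Q
  | par {P Q R : Proc} (h : Cl B P Q) (hR : R.Closed) : Cl B (.par P R) (.par Q R)
  | nu {P Q : Proc}
      (h : ∀ c, c ∉ P.fn → c ∉ Q.fn → Cl B (P.openAt 0 c) (Q.openAt 0 c)) : Cl B (.nu P) (.nu Q)

/-- An equivariant simulation with identical labels between closed processes that have the same
free names. -/
structure IsNamedSim (B : Proc → Proc → Prop) : Prop where
  closed : ∀ {P Q}, B P Q → P.Closed ∧ Q.Closed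
  fn_eq : ∀ {P Q}, B P Q → P.fn = Q.fn
  perm : ∀ {P Q} (π : Equiv.Perm Name), B P Q → B (P.perm π) (Q.perm π)
  sim : ∀ {P Q α P'}, B P Q → Step P α P' → ∃ Q', Weak Q α Q' ∧ B P' Q'

theorem Cl.flip {B : Proc → Proc → Prop} {P Q : Proc} (h : Cl B P Q) : Cl (flip B) Q P := by
  induction h with
  | base h => exact .base h
  | par _ hR ih => exact .par ih hR
  | nu _ ih => exact .nu fun c h₁ h₂ => ih c h₂ h₁

section

variable {B : Proc → Proc → Prop} {P Q : Proc}

theorem IsNamedSim.cl_closed (hB : IsNamedSim B) (h : Cl B P Q) : P.Closed ∧ Q.Closed := by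
  induction h with
  | base h => exact hB.closed h
  | par _ hR ih =>
    simp only [Proc.Closed, Proc.WF] at ih hR ⊢
    exact ⟨⟨ih.1, hR⟩, ⟨ih.2, hR⟩⟩
  | @nu P Q _ ih =>
    obtain ⟨c, hc⟩ := Infinite.exists_notMem_finset (P.fn ∪ Q.fn)
    rw [Finset.mem_union, not_or] at hc
    have := ih c hc.1 hc.2
    simpa only [Proc.Closed, Proc.WF, Proc.wf_openAt] using this

theorem IsNamedSim.cl_fn_eq (hB : IsNamedSim B) (h : Cl B P Q) : P.fn = Q.fn := by
  induction h with
  | base h => exact hB.fn_eq h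
  | par _ _ ih => simp only [Proc.fn, ih]
  | @nu P Q _ ih =>
    obtain ⟨c, hc⟩ := Infinite.exists_notMem_finset (P.fn ∪ Q.fn)
    rw [Finset.mem_union, not_or] at hc
    have := ih c hc.1 hc.2
    simp only [Proc.fn]
    ext x
    by_cases hx : x = c
    · subst hx
      simp [hc]
    · rw [← Proc.mem_fn_openAt hx P 0, this, Proc.mem_fn_openAt hx Q 0]

/-- Under a restriction the premise covers all fresh names, and a bijection carries these onto the
names fresh for the renamed processes. -/
theorem IsNamedSim.cl_perm (hB : IsNamedSim B) (π : Equiv.Perm Name) (h : Cl B P Q) :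
    Cl B (P.perm π) (Q.perm π) := by
  induction h with
  | base h => exact .base (hB.perm π h)
  | par _ hR ih =>
    simp only [Proc.perm]
    exact .par ih ((Proc.wf_perm π _ 0 0).2 hR)
  | @nu P Q _ ih =>
    simp only [Proc.perm]
    refine .nu fun c h₁ h₂ => ?_
    obtain ⟨c, rfl⟩ := π.surjective c
    rw [Proc.mem_fn_perm] at h₁ h₂
    simpa only [Proc.perm_openAt] using ih c h₁ h₂

/-- The hypothesis speaks of the single name `c`, but the binder must be opened at every fresh `d`;
the result differs from the original pair by a transposition, so equivariance suffices. -/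
theorem IsNamedSim.cl_res (hB : IsNamedSim B) (c : Name) (h : Cl B P Q) :
    Cl B (P.res c) (Q.res c) := by
  refine .nu fun d h₁ h₂ => ?_
  rw [Proc.mem_fn_closeAt] at h₁ h₂
  obtain ⟨hP, hQ⟩ := hB.cl_closed h
  rw [Proc.openAt_closeAt hP (by tauto), Proc.openAt_closeAt hQ (by tauto)]
  exact hB.cl_perm _ h

theorem IsNamedSim.cl_resList (hB : IsNamedSim B) (bs : List Name) (h : Cl B P Q) :
    Cl B (P.resList bs) (Q.resList bs) := by
  induction bs with
  | nil => exact h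
  | cons b bs ih => exact hB.cl_res b ih

/-- Identical labels let a parallel component communicate with either process in the same way and
reach the same derivative; restrictions created by extrusion are absorbed by `cl_resList`. -/
theorem IsNamedSim.cl_sim (hB : IsNamedSim B) (h : Cl B P Q) :
    ∀ {α P'}, Step P α P' → ∃ Q', Weak Q α Q' ∧ Cl B P' Q' := by
  induction h with
  | base h =>
    intro α P' hs
    obtain ⟨Q', hw, h'⟩ := hB.sim h hs
    exact ⟨Q', hw, .base h'⟩
  | @par P Q R h hR ih =>
    intro α X hs
    have hfn := hB.cl_fn_eq h
    cases hs with
    | parL hs hb =>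
      obtain ⟨Q', hw, h'⟩ := ih hs
      exact ⟨_, hw.parL hb, .par h' hR⟩
    | parR hs hb =>
      exact ⟨_, ⟨_, .refl, .inl (hs.parR (hfn ▸ hb))⟩, .par h (hs.closed hR)⟩
    | reactL h₁ h₂ hb =>
      obtain ⟨Q', hw, h'⟩ := ih h₁
      obtain ⟨Q₁, hw, hs⟩ := hw.exists_step (by simp)
      exact ⟨_, ⟨_, hw.parL R, .inl (hs.reactL h₂ hb)⟩,
        hB.cl_resList _ (.par h' (h₂.closed hR))⟩
    | reactR h₁ h₂ hb =>
      obtain ⟨Q', hw, h'⟩ := ih h₁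
      obtain ⟨Q₁, hw, hs⟩ := hw.exists_step (by simp)
      refine ⟨_, ⟨_, hw.parL R, .inl (hs.reactR h₂ ?_)⟩,
        hB.cl_resList _ (.par h' (h₂.closed hR))⟩
      -- Internal steps create no free names, so `Q₁` has at most those of `Q`, which are those of
      -- `P`.
      exact hb.mono_right (hfn ▸ hw.fn_subset)
  | @nu P Q h ih =>
    intro α X hs
    have hfn : P.fn = Q.fn := by simpa only [Proc.fn] using hB.cl_fn_eq (.nu h)
    cases hs with
    | @guard c _ P' _ hc hs hα =>
      have hc' : c ∉ Q.fn := hfn ▸ hc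
      obtain ⟨Q', hw, h'⟩ := ih c hc hc' hs
      refine ⟨_, ?_, hB.cl_res c h'⟩
      rw [← Proc.res_openAt hc']
      exact hw.res (hB.cl_closed (h c hc hc')).2 hα
    | @extr c _ P' bs a M hc hs hca hcM hcb =>
      have hc' : c ∉ Q.fn := hfn ▸ hc
      obtain ⟨Q', hw, h'⟩ := ih c hc hc' hs
      obtain ⟨Q₁, hw, hs⟩ := hw.exists_step (by simp)
      have hQ := (hB.cl_closed (h c hc hc')).2
      -- The internal steps take place under the restriction of `c`; extrusion then reopens the
      -- result with that same `c`, recovering `Q₁`.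
      refine ⟨_, ⟨_, ?_, .inl (Step.extr (c := c) (P := Q₁.closeAt 0 c) ?_ ?_ hca hcM hcb)⟩, h'⟩
      · rw [← Proc.res_openAt hc']
        exact hw.res c hQ
      · simp [Proc.mem_fn_closeAt]
      · rwa [Proc.openAt_closeAt_self (hw.closed hQ)]

theorem IsNamedSim.cl_barb (hB : IsNamedSim B) (h : Cl B P Q) {μ : Barb} (hμ : P.HasBarb μ) :
    Q.HasWeakBarb μ := by
  cases μ with
  | inp a =>
    obtain ⟨M, P', hs⟩ := hμ
    obtain ⟨Q', hw, -⟩ := hB.cl_sim h hs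
    obtain ⟨Q₁, hw, hs⟩ := hw.exists_step (by simp)
    exact ⟨Q₁, hw, M, Q', hs⟩
  | out a =>
    obtain ⟨bs, M, P', hs⟩ := hμ
    obtain ⟨Q', hw, -⟩ := hB.cl_sim h hs
    obtain ⟨Q₁, hw, hs⟩ := hw.exists_step (by simp)
    exact ⟨Q₁, hw, bs, M, Q', hs⟩

theorem IsNamedSim.cl_tau (hB : IsNamedSim B) (h : Cl B P Q) {P' : Proc}
    (hs : Step P .tau P') : ∃ Q', WeakTau Q Q' ∧ Cl B P' Q' := by
  obtain ⟨Q', hw, h'⟩ := hB.cl_sim h hs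
  exact ⟨Q', weak_tau_iff.1 hw, h'⟩

theorem IsNamedSim.isBarbed (hB : IsNamedSim B) (hB' : IsNamedSim (flip B)) :
    IsBarbed (Cl B) where
  closed_left h := (hB.cl_closed h).1
  closed_right h := (hB.cl_closed h).2
  tau_left h hs := hB.cl_tau h hs
  tau_right h hs := by
    obtain ⟨P', hw, h'⟩ := hB'.cl_tau h.flip hs
    exact ⟨P', hw, h'.flip⟩
  barb_left h hμ := hB.cl_barb h hμ
  barb_right h hμ := hB'.cl_barb h.flip hμ
  par h _ hR := .par h hR

end

/-! ### Hosting a process in a passivatable location -/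

/-- The handler `a(Y).a[run(Y)]`. -/
def handler (a : NameRef) : Proc := .inp a (.loc a (.run (.var 0)))

/-- Parallel compositions of `0`, handlers and replicated handlers. -/
inductive Inert (a : NameRef) : Proc → Prop
  | nil : Inert a .nil
  | handler : Inert a (handler a)
  | bang : Inert a (.bang (handler a))
  | par {T U : Proc} (hT : Inert a T) (hU : Inert a U) : Inert a (.par T U)

/-- `P` behind zero or more quotations that are still to be run. -/
inductive Wrap (P : Proc) : Proc → Prop
  | refl : Wrap P P
  | run {Q : Proc} (h : Wrap P Q) : Wrap P (.run (.quote Q))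

/-- Parallel compositions of one location `a` hosting `P` with inert processes. -/
inductive Host (a : NameRef) (P : Proc) : Proc → Prop
  | loc {Q : Proc} (h : Wrap P Q) : Host a P (.loc a Q)
  | parL {T U : Proc} (hT : Host a P T) (hU : Inert a U) : Host a P (.par T U)
  | parR {T U : Proc} (hT : Inert a T) (hU : Host a P U) : Host a P (.par T U)

variable {a : NameRef} {P Q T U : Proc} {f : Name}

/-! #### Syntactic operations -/

theorem Inert.openAt (k : ℕ) (c : Name) (h : Inert a T) :
    Inert (a.openAt k c) (T.openAt k c) := by
  induction h with
  | nil => simp only [Proc.openAt]; exact .nil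
  | handler => simp only [HOPiP.handler, Proc.openAt, Tm.openAt]; exact .handler
  | bang => simp only [HOPiP.handler, Proc.openAt, Tm.openAt]; exact .bang
  | par _ _ h₁ h₂ => simp only [Proc.openAt]; exact .par h₁ h₂

theorem Inert.closeAt (k : ℕ) (c : Name) (h : Inert a T) :
    Inert (a.closeAt k c) (T.closeAt k c) := by
  induction h with
  | nil => simp only [Proc.closeAt]; exact .nil
  | handler => simp only [HOPiP.handler, Proc.closeAt, Tm.closeAt]; exact .handler
  | bang => simp only [HOPiP.handler, Proc.closeAt, Tm.closeAt]; exact .bang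
  | par _ _ h₁ h₂ => simp only [Proc.closeAt]; exact .par h₁ h₂

theorem Inert.perm (π : Equiv.Perm Name) (h : Inert a T) : Inert (a.perm π) (T.perm π) := by
  induction h with
  | nil => simp only [Proc.perm]; exact .nil
  | handler => simp only [HOPiP.handler, Proc.perm, Tm.perm]; exact .handler
  | bang => simp only [HOPiP.handler, Proc.perm, Tm.perm]; exact .bang
  | par _ _ h₁ h₂ => simp only [Proc.perm]; exact .par h₁ h₂

theorem Inert.fn_subset (h : Inert a T) : T.fn ⊆ a.fn := by
  induction h with
  | nil => simp [Proc.fn]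
  | handler => simp [HOPiP.handler, Proc.fn, Tm.fn]
  | bang => simp [HOPiP.handler, Proc.fn, Tm.fn]
  | par _ _ h₁ h₂ => simp only [Proc.fn]; exact Finset.union_subset h₁ h₂

theorem Inert.wf {n : ℕ} (ha : a.WF n) (h : Inert a T) : T.WF n 0 := by
  induction h with
  | nil => simp [Proc.WF]
  | handler => simp [HOPiP.handler, Proc.WF, Tm.WF, ha]
  | bang => simp [HOPiP.handler, Proc.WF, Tm.WF, ha]
  | par _ _ h₁ h₂ => simp only [Proc.WF]; exact ⟨h₁, h₂⟩

theorem Wrap.openAt (k : ℕ) (c : Name) (h : Wrap P Q) :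
    Wrap (P.openAt k c) (Q.openAt k c) := by
  induction h with
  | refl => exact .refl
  | run _ ih => simp only [Proc.openAt, Tm.openAt]; exact .run ih

theorem Wrap.closeAt (k : ℕ) (c : Name) (h : Wrap P Q) :
    Wrap (P.closeAt k c) (Q.closeAt k c) := by
  induction h with
  | refl => exact .refl
  | run _ ih => simp only [Proc.closeAt, Tm.closeAt]; exact .run ih

theorem Wrap.perm (π : Equiv.Perm Name) (h : Wrap P Q) : Wrap (P.perm π) (Q.perm π) := by
  induction h with
  | refl => exact .refl
  | run _ ih => simp only [Proc.perm, Tm.perm]; exact .run ih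

theorem Wrap.fn_eq (h : Wrap P Q) : Q.fn = P.fn := by
  induction h with
  | refl => rfl
  | run _ ih => simpa only [Proc.fn, Tm.fn] using ih

theorem Wrap.wf {n v : ℕ} (h : Wrap P Q) (hP : P.WF n v) : Q.WF n v := by
  induction h with
  | refl => exact hP
  | run _ ih => simpa only [Proc.WF, Tm.WF] using ih

theorem Host.openAt (k : ℕ) (c : Name) (h : Host a P T) :
    Host (a.openAt k c) (P.openAt k c) (T.openAt k c) := by
  induction h with
  | loc h => simp only [Proc.openAt]; exact .loc (h.openAt k c)
  | parL _ hU ih => simp only [Proc.openAt]; exact .parL ih (hU.openAt k c)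
  | parR hT _ ih => simp only [Proc.openAt]; exact .parR (hT.openAt k c) ih

theorem Host.closeAt (k : ℕ) (c : Name) (h : Host a P T) :
    Host (a.closeAt k c) (P.closeAt k c) (T.closeAt k c) := by
  induction h with
  | loc h => simp only [Proc.closeAt]; exact .loc (h.closeAt k c)
  | parL _ hU ih => simp only [Proc.closeAt]; exact .parL ih (hU.closeAt k c)
  | parR hT _ ih => simp only [Proc.closeAt]; exact .parR (hT.closeAt k c) ih

theorem Host.perm (π : Equiv.Perm Name) (h : Host a P T) :
    Host (a.perm π) (P.perm π) (T.perm π) := by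
  induction h with
  | loc h => simp only [Proc.perm]; exact .loc (h.perm π)
  | parL _ hU ih => simp only [Proc.perm]; exact .parL ih (hU.perm π)
  | parR hT _ ih => simp only [Proc.perm]; exact .parR (hT.perm π) ih

theorem Host.fn_eq (h : Host a P T) : T.fn = a.fn ∪ P.fn := by
  induction h with
  | loc h => simp only [Proc.fn, h.fn_eq]
  | parL _ hU ih =>
    have := hU.fn_subset
    simp only [Proc.fn, ih]
    grind
  | parR hT _ ih =>
    have := hT.fn_subset
    simp only [Proc.fn, ih]
    grind

theorem Host.wf {n : ℕ} (h : Host a P T) (ha : a.WF n) (hP : P.WF n 0) : T.WF n 0 := by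
  induction h with
  | loc h => simp only [Proc.WF]; exact ⟨ha, h.wf hP⟩
  | parL _ hU ih => simp only [Proc.WF]; exact ⟨ih, hU.wf ha⟩
  | parR hT _ ih => simp only [Proc.WF]; exact ⟨hT.wf ha, ih⟩

/-! #### Transitions -/

theorem resList_nil (P : Proc) : P.resList [] = P := rfl

theorem Step.handler_inv {α : Act} {X : Proc} (h : Step (handler (.free f)) α X) :
    ∃ M, α = .inp f M ∧ ∀ Q, M = .quote Q → Host (.free f) Q X := by
  cases h with
  | @hoIn _ _ M hM =>
    refine ⟨M, rfl, ?_⟩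
    rintro Q rfl
    simp only [Proc.subst, Tm.subst, if_true]
    -- The restarted location contains the received process under one pending `run`.
    exact .loc (.run .refl)

/-- The premise of `rep` is a transition of the replication beside one copy, so induction on the
derivation must treat both shapes together. Handlers never output, hence no communication among
them. -/
theorem Step.bang_handler_inv {S X : Proc} {α : Act} (h : Step S α X) :
    (S = .bang (handler (.free f)) ∨ S = .par (.bang (handler (.free f))) (handler (.free f))) →
    ∃ M, α = .inp f M ∧ ∀ Q, M = .quote Q → Host (.free f) Q X := by
  induction h with
  | hoIn | hoOut | guard | extr | transp | passiv | run => simp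
  | parL h _ ih =>
    simp only [reduceCtorEq, false_or, Proc.par.injEq]
    rintro ⟨rfl, rfl⟩
    obtain ⟨M, rfl, hX⟩ := ih (.inl rfl)
    exact ⟨M, rfl, fun Q hQ => .parL (hX Q hQ) .handler⟩
  | parR h _ ih =>
    simp only [reduceCtorEq, false_or, Proc.par.injEq]
    rintro ⟨rfl, rfl⟩
    obtain ⟨M, rfl, hX⟩ := h.handler_inv
    exact ⟨M, rfl, fun Q hQ => .parR .bang (hX Q hQ)⟩
  | rep h ih =>
    simp only [reduceCtorEq, or_false, Proc.bang.injEq]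
    rintro rfl
    exact ih (.inr rfl)
  | reactL h₁ h₂ _ ih₁ ih₂ =>
    simp only [reduceCtorEq, false_or, Proc.par.injEq]
    rintro ⟨rfl, rfl⟩
    obtain ⟨M, hM, -⟩ := ih₁ (.inl rfl)
    cases hM
  | reactR h₁ h₂ _ ih₁ ih₂ =>
    simp only [reduceCtorEq, false_or, Proc.par.injEq]
    rintro ⟨rfl, rfl⟩
    obtain ⟨M, hM, -⟩ := h₂.handler_inv
    cases hM

theorem Inert.step_inv (hT : Inert (.free f) T) : ∀ {α X}, Step T α X →
    ∃ M, α = .inp f M ∧ ∀ Q, M = .quote Q → Host (.free f) Q X := by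
  induction hT with
  | nil => intro α X h; cases h
  | handler => exact fun h => h.handler_inv
  | bang => exact fun h => h.bang_handler_inv (.inl rfl)
  | par hT hU ih₁ ih₂ =>
    intro α X h
    cases h with
    | parL h _ =>
      obtain ⟨M, rfl, hX⟩ := ih₁ h
      exact ⟨M, rfl, fun Q hQ => .parL (hX Q hQ) hU⟩
    | parR h _ =>
      obtain ⟨M, rfl, hX⟩ := ih₂ h
      exact ⟨M, rfl, fun Q hQ => .parR hT (hX Q hQ)⟩
    | reactL h₁ _ _ =>
      obtain ⟨M, hM, -⟩ := ih₁ h₁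
      cases hM
    | reactR _ h₂ _ =>
      obtain ⟨M, hM, -⟩ := ih₂ h₂
      cases hM

/-- Passivation may strike before the pending `run`s have fired; a restart then adds a further
layer, and layers compose. -/
theorem Wrap.host_of_wrap {R : Proc} (h : Wrap P Q) (hT : Host a Q R) : Host a P R := by
  have trans : ∀ {S}, Wrap Q S → Wrap P S := by
    intro S hS
    induction hS with
    | refl => exact h
    | run _ ih => exact .run ih
  induction hT with
  | loc h' => exact .loc (trans h')
  | parL _ hU ih => exact .parL ih hU
  | parR hT _ ih => exact .parR hT ih

/-- The transitions of a host: internal ones that leave the hosted process as it is, those of the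
hosted process, passivation, and inputs of the handlers. -/
inductive HostStep (f : Name) (P : Proc) : Act → Proc → Prop
  | idle {X : Proc} (h : Host (.free f) P X) : HostStep f P .tau X
  | act {α : Act} {P' X : Proc} (h : Step P α P') (hX : Host (.free f) P' X) : HostStep f P α X
  | passiv {Q X : Proc} (h : Wrap P Q) (hX : Inert (.free f) X) :
      HostStep f P (.out [] f (.quote Q)) X
  | input {M : Tm} {X : Proc} : HostStep f P (.inp f M) X

theorem Step.out_mem_fn {bs : List Name} {M : Tm} {P' : Proc} (h : Step P (.out bs f M) P') :
    f ∈ P.fn :=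
  (show _ ∧ _ from h.namesLe).1

/-- As `P` does not know `f`, the only output at `f` is passivation, so a communication between
location and handler merely rehosts `P`. The derivative of a handler input is left unspecified
because the restriction on `f` will forbid that action. -/
theorem Host.step_inv (hT : Host (.free f) P T) (hf : f ∉ P.fn) :
    ∀ {α X}, Step T α X → HostStep f P α X := by
  induction hT with
  | loc hw =>
    intro α X h
    cases h with
    | transp h =>
      cases hw with
      | refl => exact .act h (.loc .refl)
      | run hw =>
        cases h with
        | run => exact .idle (.loc hw)
    | passiv => exact .passiv hw .nil
  | parL hT hU ih =>
    intro α X h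
    cases h with
    | parL h _ =>
      cases ih h with
      | idle h => exact .idle (.parL h hU)
      | act h hX => exact .act h (.parL hX hU)
      | passiv hw hX => exact .passiv hw (.par hX hU)
      | input => exact .input
    | parR h _ =>
      obtain ⟨M, rfl, -⟩ := hU.step_inv h
      exact .input
    | reactL h₁ h₂ _ =>
      obtain ⟨M, hM, hX₂⟩ := hU.step_inv h₂
      cases hM
      cases ih h₁ with
      | act h _ => exact absurd h.out_mem_fn hf
      | passiv hw hX =>
        rw [resList_nil]
        -- The roles swap: the former host is now inert and the receiving side has become the host.
        exact .idle (.parR hX (hw.host_of_wrap (hX₂ _ rfl)))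
    | reactR _ h₂ _ =>
      obtain ⟨M, hM, -⟩ := hU.step_inv h₂
      cases hM
  | parR hT hU ih =>
    intro α X h
    cases h with
    | parL h _ =>
      obtain ⟨M, rfl, -⟩ := hT.step_inv h
      exact .input
    | parR h _ =>
      cases ih h with
      | idle h => exact .idle (.parR hT h)
      | act h hX => exact .act h (.parR hT hX)
      | passiv hw hX => exact .passiv hw (.par hT hX)
      | input => exact .input
    | reactL h₁ _ _ =>
      obtain ⟨M, hM, -⟩ := hT.step_inv h₁
      cases hM
    | reactR h₁ h₂ _ =>
      obtain ⟨M, hM, hX₂⟩ := hT.step_inv h₁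
      cases hM
      cases ih h₂ with
      | act h _ => exact absurd h.out_mem_fn hf
      | passiv hw hX =>
        rw [resList_nil]
        exact .idle (.parL (hw.host_of_wrap (hX₂ _ rfl)) hX)

theorem Wrap.weakTau (h : Wrap P Q) : WeakTau Q P := by
  induction h with
  | refl => exact .refl
  | run _ ih => exact Relation.ReflTransGen.head .run ih

/-- Pending `run`s fire inside the location by transparency. The inert components have no free name
but `f`, so extruded names cannot clash with them. -/
theorem Host.weak {α : Act} {P' : Proc} (hT : Host (.free f) P T) (h : Step P α P')
    (hf : f ∉ α.names) : ∃ X, Weak T α X ∧ Host (.free f) P' X := by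
  have hb : ∀ {U}, Inert (.free f) U → Disjoint α.bn U.fn := by
    intro U hU
    refine Disjoint.mono_right hU.fn_subset ?_
    rw [NameRef.fn, Finset.disjoint_singleton_right]
    intro hmem
    cases α with
    | out bs a M => exact hf (Finset.mem_union_left _ hmem)
    | _ => simp [Act.bn] at hmem
  induction hT with
  | loc hw => exact ⟨_, ⟨_, hw.weakTau.loc _, .inl h.transp⟩, .loc .refl⟩
  | parL _ hU ih =>
    obtain ⟨X, hX, hX'⟩ := ih
    exact ⟨_, hX.parL (hb hU), .parL hX' hU⟩
  | parR hT _ ih =>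
    obtain ⟨X, hX, hX'⟩ := ih
    exact ⟨_, hX.parR (hb hT), .parR hT hX'⟩

/-- A closed process, and the same process hosted at a private location. -/
inductive Hosted : Proc → Proc → Prop
  | mk {P T : Proc} (hP : P.Closed) (hT : Host (.bound 0) P T) : Hosted P (.nu T)

theorem Host.hosted_res (hP : P.Closed) (hf : f ∉ P.fn) (hT : Host (.free f) P T) :
    Hosted P (T.res f) := by
  have := hT.closeAt 0 f
  rw [Proc.closeAt_eq_self 0 hf] at this
  simp only [NameRef.closeAt, if_true] at this
  exact .mk hP this

theorem Host.open_bound (c : Name) (hP : P.Closed) (hT : Host (.bound 0) P T) :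
    Host (.free c) P (T.openAt 0 c) := by
  have := hT.openAt 0 c
  rwa [Proc.openAt_eq_self c hP] at this

theorem Hosted.closed (h : Hosted P Q) : P.Closed ∧ Q.Closed := by
  cases h with
  | mk hP hT =>
    refine ⟨hP, ?_⟩
    simp only [Proc.Closed, Proc.WF]
    exact hT.wf (by simp [NameRef.WF]) (hP.mono (by omega) le_rfl)

theorem Hosted.fn_eq (h : Hosted P Q) : P.fn = Q.fn := by
  cases h with
  | mk hP hT => simp [Proc.fn, hT.fn_eq, NameRef.fn]

theorem Hosted.perm (π : Equiv.Perm Name) (h : Hosted P Q) : Hosted (P.perm π) (Q.perm π) := by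
  cases h with
  | mk hP hT =>
    simp only [Proc.perm]
    exact .mk ((Proc.wf_perm π _ 0 0).2 hP) (hT.perm π)

theorem Step.notMem_fn {α : Act} {P' : Proc} (h : Step P α P') (hf : f ∉ P.fn)
    (hα : f ∉ α.names) : f ∉ P'.fn := by
  have := h.namesLe
  cases α <;> simp only [Act.NamesLe, Act.names, Finset.mem_union, List.mem_toFinset] at this hα <;>
    grind

theorem Hosted.isNamedSim : IsNamedSim Hosted where
  closed := Hosted.closed
  fn_eq := Hosted.fn_eq
  perm := Hosted.perm
  sim := by
    rintro P _ α P' ⟨hP, hT⟩ hs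
    rename_i T
    -- Freshness for `T` permits opening the binder with `c`, freshness for `α` lets the action pass
    -- it, and freshness for `P` and `α` keeps `c` out of the derivative of `P`.
    obtain ⟨c, hc⟩ := Infinite.exists_notMem_finset (P.fn ∪ (T.fn ∪ α.names))
    simp only [Finset.mem_union, not_or] at hc
    obtain ⟨hcP, hcT, hcα⟩ := hc
    have hTc := hT.open_bound c hP
    obtain ⟨X, hX, hX'⟩ := hTc.weak hs hcα
    refine ⟨_, ?_, hX'.hosted_res (hs.closed hP) (hs.notMem_fn hcP hcα)⟩
    rw [← Proc.res_openAt hcT]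
    exact hX.res (hTc.wf (by simp [NameRef.WF]) hP) hcα

/-- Through the restriction only rehosting, unquoting and the actions of `P` remain visible.
Extrusion of the location name is impossible, since neither `P` nor its messages contain it. -/
theorem Hosted.isNamedSim_flip : IsNamedSim (flip Hosted) where
  closed h := (Hosted.closed h).symm
  fn_eq h := (Hosted.fn_eq h).symm
  perm π h := Hosted.perm π h
  sim := by
    rintro _ P α X ⟨hP, hT⟩ hs
    rename_i T
    have hfn := hT.fn_eq
    rw [NameRef.fn, Finset.empty_union] at hfn
    cases hs with
    | @guard c _ X _ hc hs hα =>
      rw [hfn] at hc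
      cases (hT.open_bound c hP).step_inv hc hs with
      | idle h => exact ⟨P, weak_tau_iff.2 .refl, h.hosted_res hP hc⟩
      | act h hX =>
        exact ⟨_, ⟨P, .refl, .inl h⟩, hX.hosted_res (h.closed hP) (h.notMem_fn hc hα)⟩
      | passiv h hX => simp [Act.names] at hα
      | input => simp [Act.names] at hα
    | @extr c _ _ bs b M hc hs hcb hcM hcbs =>
      rw [hfn] at hc
      cases (hT.open_bound c hP).step_inv hc hs with
      | act h hX =>
        -- A name in a message of `P` is free in `P` or already extruded by it; `c` is neither.
        exact ((show _ ∧ _ ∧ _ from h.namesLe).2.1 c hcM).elim (absurd · hc) (absurd · hcbs)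
      | passiv h hX => exact absurd rfl hcb

/-- A closed process is equivalent to the same process hosted at a private location whose content
may be passivated and restarted at any time. -/
theorem barbedEquiv_hosted (hP : P.Closed) (hf : f ∉ P.fn) :
    BarbedEquiv P (.res f (.par (.loc f P) (.bang (handler f)))) :=
  ⟨Cl Hosted, Hosted.isNamedSim.isBarbed Hosted.isNamedSim_flip,
    .base (Host.hosted_res hP hf (.parL (.loc .refl) .bang))⟩

end HOPiP

/-- `c(X).run(X) ≈ νf.(f[c(X).run(X)] | !f(Y).f[run(Y)])` -/
theorem mainTheorem4 (c f : Name) (hcf : c ≠ f) :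
    BarbedEquiv
      (.inp c (.run (.var 0)))
      (.res f (.par
        (.loc f (.inp c (.run (.var 0))))
        (.bang (.inp f (.loc f (.run (.var 0))))))) := by
  refine barbedEquiv_hosted ?_ ?_
  · simp [Proc.Closed, Proc.WF, Tm.WF, NameRef.WF]
  -- The only free name of the hosted process is `c`.
  · simpa [Proc.fn, Tm.fn, NameRef.fn] using hcf.symm
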